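/- Let $M$ be a Hausdorff smooth manifold (without boundary) of dimension $n$ and let $\nabla$ be a symmetric (torsion-free) affine connection on $M$ of class $C^\infty$. In a smooth chart $(x^1,\dots,x^n)$ its components $\Gamma^i_{jk}$ are defined by $\nabla_{\partial_j}\partial_k=\Gamma^i_{jk}\,\partial_i$, and the components of its curvature tensor field are $$R^l{}_{ijk}=\frac{\partial \Gamma^l_{ik}}{\partial x^j}-\frac{\partial \Gamma^l_{ij}}{\partial x^k}+\Gamma^l_{js}\Gamma^s_{ik}-\Gamma^l_{ks}\Gamma^s_{ij}$$ (repeated indices are summed from $1$ to $n$). The following statements are equivalent. (i) The curvature vanishes: in every smooth chart, $R^l{}_{ijk}=0$ on the whole chart domain for all $i,j,k,l$. (ii) For each point of $M$ there is a smooth chart whose domain contains that point and on whose whole domain $\Gamma^i_{jk}=0$ for all $i,j,k$. (iii) For each point of $M$ there is a smooth chart whose domain contains that point and on whose whole domain $$\frac{\partial \Gamma^l_{is}}{\partial x^p}=0\quad\text{and}\quad \Gamma^l_{pm}\Gamma^m_{is}=0\qquad\text{for all } l,p,i,s.$$ (iv) For each point of $M$ there is a smooth chart whose domain contains that point and on whose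 whole domain $$\frac{\partial \Gamma^l_{is}}{\partial x^p}+\Gamma^l_{pm}\Gamma^m_{is}=0\qquad\text{for all } l,p,i,s.$$ -/

import Mathlib

open scoped Manifold ContDiff

noncomputable section

namespace AffineManifold

variable {n : ℕ} {M : Type*} [TopologicalSpace M] [ChartedSpace (EuclideanSpace ℝ (Fin n)) M]

/-- The `i`-th standard basis vector of `ℝⁿ`. -/
def stdVec {n : ℕ} (i : Fin n) : EuclideanSpace ℝ (Fin n) := EuclideanSpace.single i 1

/-- The coordinate vector field `∂/∂xⁱ` of a chart `φ = (x¹, …, xⁿ)`: the pullback by `φ` of the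
constant field `eᵢ` on `ℝⁿ`. It is meaningful on the domain `φ.source`. -/
def coordField (φ : OpenPartialHomeomorph M (EuclideanSpace ℝ (Fin n))) (i : Fin n) (p : M) :
    TangentSpace (𝓡 n) p :=
  VectorField.mpullback (𝓡 n) (𝓡 n) φ (fun _ ↦ stdVec i) p

/-- The `l`-th component `dxˡ(v)` of a tangent vector `v` at `p` in a chart `φ = (x¹, …, xⁿ)`. -/
def coordComp (φ : OpenPartialHomeomorph M (EuclideanSpace ℝ (Fin n))) (l : Fin n) (p : M)
    (v : TangentSpace (𝓡 n) p) : ℝ :=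
  let w : EuclideanSpace ℝ (Fin n) := mfderiv (𝓡 n) (𝓡 n) φ p v
  w l

/-- The partial derivative `∂f/∂xᵖ` at `q` of a function `f` on `M`, in a chart `φ`: the
derivative of `f ∘ φ⁻¹` at `φ q` in the direction of the `p`-th basis vector. -/
def chartPartial (φ : OpenPartialHomeomorph M (EuclideanSpace ℝ (Fin n))) (p : Fin n)
    (f : M → ℝ) (q : M) : ℝ :=
  fderiv ℝ (fun y ↦ f (φ.symm y)) (φ q) (stdVec p)

/-- The component `Γˡᵢⱼ = dxˡ(∇_{∂ᵢ} ∂ⱼ)` of the connection `∇` in the chart `φ`, as a function on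
the domain of `φ`. Mathlib writes `∇_X Y` at `p` as `cov Y p (X p)`. -/
def christoffel
    [IsManifold (𝓡 n) ∞ M]
    (cov : CovariantDerivative (𝓡 n) (EuclideanSpace ℝ (Fin n))
      (TangentSpace (𝓡 n) : M → Type _))
    (φ : OpenPartialHomeomorph M (EuclideanSpace ℝ (Fin n))) (l i j : Fin n) (q : M) : ℝ :=
  coordComp φ l q (cov (coordField φ j) q (coordField φ i q))

/-- The component `Rˡᵢⱼₖ = ∂ⱼ Γˡᵢₖ - ∂ₖ Γˡᵢⱼ + Γˡⱼₛ Γˢᵢₖ - Γˡₖₛ Γˢᵢⱼ` (summed over `s`) of the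
curvature tensor field of `∇` in the chart `φ`. -/
def curvature
    [IsManifold (𝓡 n) ∞ M]
    (cov : CovariantDerivative (𝓡 n) (EuclideanSpace ℝ (Fin n))
      (TangentSpace (𝓡 n) : M → Type _))
    (φ : OpenPartialHomeomorph M (EuclideanSpace ℝ (Fin n))) (l i j k : Fin n) (q : M) : ℝ :=
  chartPartial φ j (christoffel cov φ l i k) q - chartPartial φ k (christoffel cov φ l i j) q
    + ∑ s, christoffel cov φ l j s q * christoffel cov φ s i k q
    - ∑ s, christoffel cov φ l k s q * christoffel cov φ s i j q

/-- The curvature tensor field vanishes: all its components vanish in all smooth charts, at all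
points of their domains. -/
def IsCurvatureFlat
    [IsManifold (𝓡 n) ∞ M]
    (cov : CovariantDerivative (𝓡 n) (EuclideanSpace ℝ (Fin n))
      (TangentSpace (𝓡 n) : M → Type _)) : Prop :=
  ∀ φ ∈ IsManifold.maximalAtlas (𝓡 n) ∞ M, ∀ q ∈ φ.source, ∀ l i j k : Fin n,
    curvature cov φ l i j k q = 0

end AffineManifold

end

/-! In a chart, the Christoffel symbols form an endomorphism-valued 1-form Γ (`connForm`). For a
torsion-free connection, the curvature vanishes exactly when `DΓ v w + Γ v Γ w` is symmetric in `v`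
and `w`, which is the integrability condition of `dΦ = Φ Γ`.

From flatness in a single chart, the Frobenius theorem `exists_hasFDerivAt_mul_of_flat` gives a
solution Φ with value 1 at the base point. Since Γ is symmetric, Φ is a closed vector-valued 1-form,
so `Φ = Df` locally, and f is a coordinate change by the inverse function theorem. The new
coordinate fields have components `Φ⁻¹ eₐ`; as `d(Φ⁻¹) = -Γ Φ⁻¹`, they are parallel, so the new
Christoffel symbols vanish.

Conversely, if ψ has vanishing symbols and f is the transition from any chart φ to ψ, then `W =
(Df)⁻¹` satisfies `dW = -Γ W`. Symmetry of the second derivative of W and invertibility of W give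
flatness in φ. Thus flatness passes from one chart around each point to all charts without a
transformation law for the curvature. This closes the cycle, because the expressions in (iv)
antisymmetrize to the curvature. -/

section

open Metric Set Filter Topology

/-! ### Linear ordinary differential equations in a normed algebra -/

section LinearODE

variable {𝔸 : Type*} [NormedRing 𝔸] [NormedAlgebra ℝ 𝔸]

/-- A linear equation `s' = s a` with small continuous coefficient is solvable on `[0, 1]`. -/
theorem exists_hasDerivWithinAt_mul_right [CompleteSpace 𝔸] {a : ℝ → 𝔸}
    (ha : ContinuousOn a (Icc 0 1))
    (hbound : ∀ t ∈ Icc (0 : ℝ) 1, ‖a t‖ ≤ 1 / 2) (c : 𝔸) :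
    ∃ s : ℝ → 𝔸, s 0 = c ∧
      ∀ t ∈ Icc (0 : ℝ) 1, HasDerivWithinAt s (s t * a t) (Icc 0 1) t := by
  -- On the ball of radius `‖c‖` about `c` one has `‖y‖ ≤ 2‖c‖`, so the bound 1/2 on the coefficient
  -- keeps the speed at most `‖c‖`, and the solution stays in the ball for time 1.
  have hPL : IsPicardLindelof (fun t (y : 𝔸) ↦ y * a t) (tmin := 0) (tmax := 1)
      ⟨0, by simp⟩ c ‖c‖₊ 0 ‖c‖₊ 1 := by
    refine ⟨fun t ht ↦ ?_, fun y _ ↦ ?_, fun t ht y hy ↦ ?_, ?_⟩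
    · refine LipschitzOnWith.of_dist_le_mul fun x _ y _ ↦ ?_
      rw [dist_eq_norm, dist_eq_norm, ← sub_mul, NNReal.coe_one, one_mul]
      refine (norm_mul_le _ _).trans ?_
      have := hbound t ht
      nlinarith [norm_nonneg (x - y)]
    · exact continuousOn_const.mul ha
    · refine (norm_mul_le _ _).trans ?_
      have h1 := hbound t ht
      have h2 : ‖y‖ ≤ 2 * ‖c‖ := by
        have h3 : ‖y - c‖ ≤ ‖c‖ := by simpa [dist_eq_norm] using hy
        have h4 := norm_add_le (y - c) c
        rw [sub_add_cancel] at h4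
        linarith
      rw [coe_nnnorm]
      nlinarith [norm_nonneg y, norm_nonneg (a t)]
    · simp
  exact hPL.exists_eq_forall_mem_Icc_hasDerivWithinAt₀

/-- Stability of the linear equation `s' = s a` on `[0, 1]`. -/
theorem norm_sub_le_of_approx_mul_right {a : ℝ → 𝔸}
    (hbound : ∀ t ∈ Icc (0 : ℝ) 1, ‖a t‖ ≤ 1 / 2) {s b b' : ℝ → 𝔸} {ε : ℝ}
    (hs : ∀ t ∈ Icc (0 : ℝ) 1, HasDerivWithinAt s (s t * a t) (Icc 0 1) t)
    (hb : ∀ t ∈ Icc (0 : ℝ) 1, HasDerivWithinAt b (b' t) (Icc 0 1) t)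
    (hε : ∀ t ∈ Icc (0 : ℝ) 1, ‖b' t - b t * a t‖ ≤ ε) (h0 : s 0 = b 0) :
    ‖s 1 - b 1‖ ≤ ε * (Real.exp 1 - 1) := by
  have key := norm_le_gronwallBound_of_norm_deriv_right_le (f := fun t ↦ s t - b t)
    (f' := fun t ↦ s t * a t - b' t) (δ := 0) (K := 1) (ε := ε) (a := 0) (b := 1)
    (fun t ht ↦ ((hs t ht).sub (hb t ht)).continuousWithinAt)
    (fun t ht ↦ ((hs t (Ico_subset_Icc_self ht)).sub
      (hb t (Ico_subset_Icc_self ht))).mono_of_mem_nhdsWithin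
        (mem_of_superset (Icc_mem_nhdsGE ht.2) (Icc_subset_Icc_left ht.1)))
    (by simp [h0])
    (fun t ht ↦ by
      have ht' := Ico_subset_Icc_self ht
      have e : s t * a t - b' t = (s t - b t) * a t - (b' t - b t * a t) := by noncomm_ring
      rw [e]
      refine (norm_sub_le _ _).trans (add_le_add ((norm_mul_le _ _).trans ?_) (hε t ht'))
      nlinarith [hbound t ht', norm_nonneg (s t - b t)]) 1 (by simp)
  rw [gronwallBound_of_K_ne_0 one_ne_zero] at key
  simpa using key

end LinearODE

/-! ### The Frobenius theorem by transport along rays -/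

section Frobenius

variable {E : Type*} [NormedAddCommGroup E] [NormedSpace ℝ E]
  {𝔸 : Type*} [NormedRing 𝔸] [NormedAlgebra ℝ 𝔸]

/-- Uniform constants for the transport estimates. The bound `K * r ≤ 1 / 2` makes the coefficient
`A (x₀ + t • u) u` small enough for the linear equation, and the Lipschitz bound on the derivative,
valid since `A` is C², controls Taylor remainders quadratically. -/
theorem exists_ball_bounds_of_contDiffAt_two {F : Type*} [NormedAddCommGroup F]
    [NormedSpace ℝ F] {A : E → F} {x₀ : E} (hA : ContDiffAt ℝ 2 A x₀) {P : E → Prop}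
    (hP : ∀ᶠ x in 𝓝 x₀, P x) :
    ∃ K r : ℝ, 0 ≤ K ∧ 0 < r ∧ r ≤ 1 ∧ K * r ≤ 1 / 2 ∧ (∀ x ∈ ball x₀ r, P x) ∧
      (∀ x ∈ ball x₀ r, DifferentiableAt ℝ A x) ∧ (∀ x ∈ ball x₀ r, ‖A x‖ ≤ K) ∧
      (∀ x ∈ ball x₀ r, ‖fderiv ℝ A x‖ ≤ K) ∧
      ∀ x ∈ ball x₀ r, ∀ y ∈ ball x₀ r, ‖fderiv ℝ A x - fderiv ℝ A y‖ ≤ K * ‖x - y‖ := by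
  have hA' : ContDiffAt ℝ 1 (fderiv ℝ A) x₀ := hA.fderiv_right (by norm_num)
  obtain ⟨C, t, ht, hC⟩ := hA'.exists_lipschitzOnWith
  have e1 : ∀ᶠ x in 𝓝 x₀, DifferentiableAt ℝ A x :=
    ((hA.of_le (by norm_num : (1 : WithTop ℕ∞) ≤ 2)).eventually (by simp)).mono
      fun x hx ↦ hx.differentiableAt (by simp)
  have e2 : ∀ᶠ x in 𝓝 x₀, ‖A x‖ < ‖A x₀‖ + 1 :=
    hA.continuousAt.norm.eventually_lt_const (lt_add_one _)
  have e3 : ∀ᶠ x in 𝓝 x₀, ‖fderiv ℝ A x‖ < ‖fderiv ℝ A x₀‖ + 1 :=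
    hA'.continuousAt.norm.eventually_lt_const (lt_add_one _)
  obtain ⟨r, hr, H⟩ := Metric.eventually_nhds_iff_ball.1
    (hP.and (e1.and (e2.and (e3.and (eventually_mem_set.2 ht)))))
  set K : ℝ := ‖A x₀‖ + 1 + (‖fderiv ℝ A x₀‖ + 1) + C with hK
  have hK0 : 0 < K := by positivity
  have hC0 : (0 : ℝ) ≤ C := C.2
  have n1 := norm_nonneg (A x₀)
  have n2 := norm_nonneg (fderiv ℝ A x₀)
  refine ⟨K, min r (min 1 (1 / (2 * K))), hK0.le, by positivity,
    (min_le_right _ _).trans (min_le_left _ _), ?_, ?_⟩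
  · calc K * min r (min 1 (1 / (2 * K))) ≤ K * (1 / (2 * K)) := by
          gcongr; exact (min_le_right _ _).trans (min_le_right _ _)
      _ = 1 / 2 := by field_simp
  · have hsub : ball x₀ (min r (min 1 (1 / (2 * K)))) ⊆ ball x₀ r :=
      ball_subset_ball (min_le_left _ _)
    refine ⟨fun x hx ↦ (H x (hsub hx)).1, fun x hx ↦ (H x (hsub hx)).2.1,
      fun x hx ↦ ?_, fun x hx ↦ ?_, fun x hx y hy ↦ ?_⟩
    · have := (H x (hsub hx)).2.2.1
      linarith
    · have := (H x (hsub hx)).2.2.2.1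
      linarith
    · have := hC.dist_le_mul x (H x (hsub hx)).2.2.2.2 y (H y (hsub hy)).2.2.2.2
      rw [dist_eq_norm, dist_eq_norm] at this
      refine this.trans ?_
      gcongr
      linarith

/-- First-order comparison of the parallel transports of a flat connection form along two
nearby rays. -/
theorem norm_transport_sub_le {A : E → E →L[ℝ] 𝔸} {x₀ : E} {K r : ℝ}
    (hK : 0 ≤ K) (hr : r ≤ 1) (hKr : K * r ≤ 1 / 2)
    (hflat : ∀ x ∈ ball x₀ r, ∀ v w, fderiv ℝ A x v w + A x v * A x w =
      fderiv ℝ A x w v + A x w * A x v)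
    (hd : ∀ x ∈ ball x₀ r, DifferentiableAt ℝ A x) (hA : ∀ x ∈ ball x₀ r, ‖A x‖ ≤ K)
    (hA' : ∀ x ∈ ball x₀ r, ‖fderiv ℝ A x‖ ≤ K)
    (hL : ∀ x ∈ ball x₀ r, ∀ y ∈ ball x₀ r, ‖fderiv ℝ A x - fderiv ℝ A y‖ ≤ K * ‖x - y‖)
    {u h : E} (hu : ‖u‖ < r) (huh : ‖u + h‖ < r) {s s' : ℝ → 𝔸} (h0 : s 0 = 1) (h0' : s' 0 = 1)
    (hs : ∀ t ∈ Icc (0 : ℝ) 1, HasDerivWithinAt s (s t * A (x₀ + t • u) u) (Icc 0 1) t)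
    (hs' : ∀ t ∈ Icc (0 : ℝ) 1,
      HasDerivWithinAt s' (s' t * A (x₀ + t • (u + h)) (u + h)) (Icc 0 1) t)
    {S : ℝ} (hS : ∀ t ∈ Icc (0 : ℝ) 1, ‖s t‖ ≤ S) :
    ‖s' 1 - s 1 * (1 + A (x₀ + u) h)‖ ≤
      (S * (2 * K ^ 2 + 2 * K) * (Real.exp 1 - 1)) * ‖h‖ ^ 2 := by
  have mem : ∀ w : E, ‖w‖ < r → ∀ t ∈ Icc (0 : ℝ) 1, x₀ + t • w ∈ ball x₀ r := by
    intro w hw t ht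
    rw [mem_ball, dist_eq_norm, add_sub_cancel_left, norm_smul, Real.norm_of_nonneg ht.1]
    nlinarith [ht.2, norm_nonneg w]
  have hS0 : 0 ≤ S := (norm_nonneg _).trans (hS 0 (by simp))
  -- The comparison curve `b` is the first-order guess for the transport along the ray to `u + h`.
  -- It solves that ray's equation up to an error of order `‖h‖ ^ 2`, so stability bounds the
  -- difference at time 1.
  have key := norm_sub_le_of_approx_mul_right (a := fun t ↦ A (x₀ + t • (u + h)) (u + h))
    (s := s') (b := fun t ↦ s t * (1 + A (x₀ + t • u) (t • h)))
    (b' := fun t ↦ s t * A (x₀ + t • u) u * (1 + A (x₀ + t • u) (t • h)) +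
      s t * (fderiv ℝ A (x₀ + t • u) u (t • h) + A (x₀ + t • u) h))
    (ε := S * (2 * K ^ 2 + 2 * K) * ‖h‖ ^ 2) ?_ hs' ?_ ?_ (by simp [h0, h0'])
  · simpa [mul_right_comm] using key
  · intro t ht
    exact (ContinuousLinearMap.le_opNorm _ _).trans
      ((mul_le_mul (hA _ (mem _ huh t ht)) huh.le (norm_nonneg _) hK).trans hKr)
  · intro t ht
    refine (hs t ht).mul (HasDerivAt.hasDerivWithinAt ?_)
    refine HasDerivAt.const_add (1 : 𝔸) ?_
    have hp : HasDerivAt (fun t : ℝ ↦ x₀ + t • u) u t := by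
      simpa using ((hasDerivAt_id t).smul_const u).const_add x₀
    have hh : HasDerivAt (fun t : ℝ ↦ t • h) h t := by
      simpa using (hasDerivAt_id t).smul_const h
    have hAp : HasDerivAt (fun t : ℝ ↦ A (x₀ + t • u)) (fderiv ℝ A (x₀ + t • u) u) t :=
      (hd _ (mem u hu t ht)).hasFDerivAt.comp_hasDerivAt t hp
    exact hAp.clm_apply hh
  · intro t ht
    set p := x₀ + t • u with hp
    set p' := x₀ + t • (u + h) with hp'
    have hpp : p' - p = t • h := by rw [hp, hp']; module
    have hpm := mem u hu t ht
    have hpm' := mem _ huh t ht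
    have hth : ‖t • h‖ ≤ ‖h‖ := by
      rw [norm_smul, Real.norm_of_nonneg ht.1]
      nlinarith [ht.2, norm_nonneg h]
    have hseg : segment ℝ p p' ⊆ ball x₀ r := (convex_ball x₀ r).segment_subset hpm hpm'
    have hrho : ‖A p' - A p - fderiv ℝ A p (t • h)‖ ≤ K * ‖h‖ * ‖h‖ := by
      rw [← hpp]
      refine ((convex_segment p p').norm_image_sub_le_of_norm_fderiv_le'
        (fun x hx ↦ hd x (hseg hx)) (φ := fderiv ℝ A p) (C := K * ‖h‖) ?_
        (left_mem_segment ℝ p p') (right_mem_segment ℝ p p')).trans ?_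
      · intro x hx
        refine (hL x (hseg hx) p hpm).trans ?_
        gcongr
        have := norm_sub_le_of_mem_segment hx
        rw [hpp] at this
        exact this.trans hth
      · rw [hpp]; gcongr
    have hlip : ‖A p' - A p‖ ≤ K * ‖h‖ := by
      refine ((convex_ball x₀ r).norm_image_sub_le_of_norm_fderiv_le hd hA' hpm hpm').trans ?_
      rw [hpp]; gcongr
    -- Flatness replaces `fderiv ℝ A p u (t • h)` by `fderiv ℝ A p (t • h) u` plus a commutator; all
    -- terms of first order in `h` then cancel, leaving three quadratic ones.
    have hid : s t * A p u * (1 + A p (t • h)) + s t * (fderiv ℝ A p u (t • h) + A p h) -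
        s t * (1 + A p (t • h)) * A p' (u + h) =
        s t * (A p (t • h) * (A p u - A p' (u + h)) - fderiv ℝ A p (t • h) h -
          (A p' - A p - fderiv ℝ A p (t • h)) (u + h)) := by
      have hf := eq_sub_of_add_eq (hflat p hpm u (t • h))
      rw [hf]
      simp only [_root_.sub_apply, map_add]
      noncomm_ring
    rw [hid]
    have b1 : ‖A p (t • h)‖ ≤ K * ‖h‖ :=
      (ContinuousLinearMap.le_opNorm _ _).trans (by gcongr; exact hA p hpm)
    have b2 : ‖A p u - A p' (u + h)‖ ≤ 2 * K * ‖h‖ := by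
      have : A p u - A p' (u + h) = -((A p' - A p) (u + h) + A p h) := by
        simp only [_root_.sub_apply, map_add]; abel
      rw [this, norm_neg]
      refine (norm_add_le _ _).trans ?_
      have c1 : ‖(A p' - A p) (u + h)‖ ≤ (K * ‖h‖) * 1 :=
        (ContinuousLinearMap.le_opNorm _ _).trans (by gcongr; linarith)
      have c2 : ‖A p h‖ ≤ K * ‖h‖ :=
        (ContinuousLinearMap.le_opNorm _ _).trans (by gcongr; exact hA p hpm)
      linarith
    have b3 : ‖fderiv ℝ A p (t • h) h‖ ≤ K * ‖h‖ * ‖h‖ :=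
      (ContinuousLinearMap.le_opNorm₂ _ _ _).trans (by gcongr; exact hA' p hpm)
    have b4 : ‖(A p' - A p - fderiv ℝ A p (t • h)) (u + h)‖ ≤ K * ‖h‖ * ‖h‖ * 1 :=
      (ContinuousLinearMap.le_opNorm _ _).trans (by gcongr; linarith)
    calc _ ≤ ‖s t‖ * (‖A p (t • h)‖ * ‖A p u - A p' (u + h)‖ + ‖fderiv ℝ A p (t • h) h‖ +
          ‖(A p' - A p - fderiv ℝ A p (t • h)) (u + h)‖) := by
          refine (norm_mul_le _ _).trans ?_
          gcongr
          refine (norm_sub_le _ _).trans ?_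
          gcongr
          refine (norm_sub_le _ _).trans ?_
          gcongr
          exact norm_mul_le _ _
      _ ≤ S * ((K * ‖h‖) * (2 * K * ‖h‖) + K * ‖h‖ * ‖h‖ + K * ‖h‖ * ‖h‖ * 1) := by
          gcongr
          exact hS t ht
      _ = _ := by ring

/-- **Frobenius theorem** for a linear total differential equation `dΦ = Φ A`: if the connection
form `A` is flat near `x₀`, there is a local solution with `Φ x₀ = 1`. -/
theorem exists_hasFDerivAt_mul_of_flat [CompleteSpace 𝔸] {A : E → E →L[ℝ] 𝔸} {x₀ : E}
    (hA : ContDiffAt ℝ 2 A x₀)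
    (hflat : ∀ᶠ x in 𝓝 x₀, ∀ v w, fderiv ℝ A x v w + A x v * A x w =
      fderiv ℝ A x w v + A x w * A x v) :
    ∃ r > 0, ∃ Φ : E → 𝔸, Φ x₀ = 1 ∧
      ∀ x ∈ ball x₀ r, HasFDerivAt Φ (ContinuousLinearMap.mul ℝ 𝔸 (Φ x) ∘L A x) x := by
  obtain ⟨K, r, hK, hr, hr1, hKr, hfl, hd, hb, hb', hL⟩ :=
    exists_ball_bounds_of_contDiffAt_two hA hflat
  have mem : ∀ w : E, ‖w‖ < r → ∀ t ∈ Icc (0 : ℝ) 1, x₀ + t • w ∈ ball x₀ r := by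
    intro w hw t ht
    rw [mem_ball, dist_eq_norm, add_sub_cancel_left, norm_smul, Real.norm_of_nonneg ht.1]
    nlinarith [ht.2, norm_nonneg w]
  have hex : ∀ w : E, ∃ s : ℝ → 𝔸, s 0 = 1 ∧ (‖w‖ < r → ∀ t ∈ Icc (0 : ℝ) 1,
      HasDerivWithinAt s (s t * A (x₀ + t • w) w) (Icc 0 1) t) := by
    intro w
    by_cases hw : ‖w‖ < r
    · have hcont : ContinuousOn (fun t : ℝ ↦ A (x₀ + t • w) w) (Icc 0 1) := by
        intro t ht
        have hc : ContinuousAt (fun t : ℝ ↦ x₀ + t • w) t := by fun_prop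
        exact ((ContinuousAt.comp (f := fun t : ℝ ↦ x₀ + t • w)
          (hd _ (mem w hw t ht)).continuousAt hc).clm_apply
            continuousAt_const).continuousWithinAt
      have hsmall : ∀ t ∈ Icc (0 : ℝ) 1, ‖A (x₀ + t • w) w‖ ≤ 1 / 2 := fun t ht ↦
        (ContinuousLinearMap.le_opNorm _ _).trans
          ((mul_le_mul (hb _ (mem w hw t ht)) hw.le (norm_nonneg _) hK).trans hKr)
      obtain ⟨s, hs0, hs⟩ := exists_hasDerivWithinAt_mul_right hcont hsmall 1
      exact ⟨s, hs0, fun _ ↦ hs⟩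
    · exact ⟨fun _ ↦ 1, rfl, fun h ↦ absurd h hw⟩
  choose s hs0 hs using hex
  refine ⟨r, hr, fun x ↦ s (x - x₀) 1, ?_, fun x hx ↦ ?_⟩
  -- Along the constant ray the coefficient is zero, so stability with `ε = 0` forces the value 1.
  · have hz := hs 0 (by simpa using hr)
    have := norm_sub_le_of_approx_mul_right (a := fun _ : ℝ ↦ (0 : 𝔸)) (s := s 0)
      (b := fun _ ↦ 1) (b' := fun _ ↦ 0) (ε := 0) (by simp) (by simpa using hz)
      (fun t _ ↦ hasDerivWithinAt_const _ _ _) (by simp) (hs0 0)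
    simpa [sub_eq_zero] using this
  · set u := x - x₀ with hu
    have hux : x₀ + u = x := by rw [hu]; abel
    have hur : ‖u‖ < r := by rwa [hu, ← dist_eq_norm]
    have hsc : ContinuousOn (s u) (Icc 0 1) := fun t ht ↦ (hs u hur t ht).continuousWithinAt
    obtain ⟨S, hS⟩ := isCompact_Icc.exists_bound_of_continuousOn hsc
    -- Transports to `x` and to a nearby `y` differ from the affine model by a quadratic remainder,
    -- which has derivative zero at `x`.
    have hO : (fun y ↦ s (y - x₀) 1 - s u 1 * (1 + A x (y - x))) =O[𝓝 x]
        fun y ↦ ‖y - x‖ ^ 2 := by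
      refine Asymptotics.IsBigO.of_bound (S * (2 * K ^ 2 + 2 * K) * (Real.exp 1 - 1)) ?_
      filter_upwards [isOpen_ball.mem_nhds hx] with y hy
      have hyr : ‖u + (y - x)‖ < r := by
        rw [show u + (y - x) = y - x₀ by rw [hu]; abel, ← dist_eq_norm]; exact hy
      have := norm_transport_sub_le hK hr1 hKr hfl hd hb hb' hL hur hyr (hs0 _) (hs0 _)
        (hs u hur) (hs _ hyr) hS
      rw [hux, show u + (y - x) = y - x₀ by rw [hu]; abel] at this
      simpa using this
    have h1 := hO.hasFDerivAt (𝕜 := ℝ) one_lt_two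
    have h2 : HasFDerivAt (fun y ↦ s u 1 * (1 + A x (y - x)))
        (ContinuousLinearMap.mul ℝ 𝔸 (s u 1) ∘L A x) x := by
      have h3 : HasFDerivAt (fun y ↦ 1 + A x (y - x)) (A x) x := by
        simpa only [map_sub] using (((A x).hasFDerivAt (x := x)).sub_const (A x x)).const_add 1
      exact (ContinuousLinearMap.mul ℝ 𝔸 (s u 1)).hasFDerivAt.comp x h3
    refine ((h1.add h2).congr_fderiv (zero_add _)).congr_of_eventuallyEq
      (Eventually.of_forall fun y ↦ ?_)
    simp only [Pi.add_apply, sub_add_cancel]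

end Frobenius

/-! ### Integrability conditions and inverses of solutions -/

section FlatForms

/-- The equation reads `dW = -A W`, since the flipped product multiplies by `W` on the right.
Differentiating again gives `D²W(v, w) = (-DA v w + A w A v) W`; this is symmetric in `v, w`, and
the unit `W x` cancels. -/
theorem flat_of_eventually_hasFDerivAt_mul {E : Type*} [NormedAddCommGroup E] [NormedSpace ℝ E]
    {𝔸 : Type*} [NormedRing 𝔸] [NormedAlgebra ℝ 𝔸] {A : E → E →L[ℝ] 𝔸} {W : E → 𝔸} {x : E}
    (hA : DifferentiableAt ℝ A x)
    (hW : ∀ᶠ y in 𝓝 x, HasFDerivAt W (-((ContinuousLinearMap.mul ℝ 𝔸).flip (W y) ∘L A y)) y)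
    (hu : IsUnit (W x)) (v w : E) :
    fderiv ℝ A x v w + A x v * A x w = fderiv ℝ A x w v + A x w * A x v := by
  have h1 : HasFDerivAt (fun y ↦ (ContinuousLinearMap.mul ℝ 𝔸).flip (W y)) _ x :=
    ((ContinuousLinearMap.mul ℝ 𝔸).flip.hasFDerivAt).comp x hW.self_of_nhds
  have h2 := (h1.clm_comp hA.hasFDerivAt).neg
  have h3 := second_derivative_symmetric_of_eventually hW h2 v w
  simp only [_root_.neg_apply, _root_.add_apply,
    ContinuousLinearMap.comp_apply, ContinuousLinearMap.compL_apply,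
    ContinuousLinearMap.flip_apply, ContinuousLinearMap.mul_apply', map_neg,
    neg_inj] at h3
  refine hu.mul_left_inj.1 ?_
  simp only [add_mul, mul_assoc]
  rw [← sub_eq_zero] at h3 ⊢
  rw [← h3]
  abel

variable {E : Type*} [NormedAddCommGroup E] [NormedSpace ℝ E]

theorem ContinuousLinearMap.isUnit_iff_isInvertible {f : E →L[ℝ] E} :
    IsUnit f ↔ f.IsInvertible := by
  constructor
  · rintro ⟨u, rfl⟩
    exact ⟨ContinuousLinearEquiv.unitsEquiv ℝ E u, rfl⟩
  · rintro ⟨e, rfl⟩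
    exact ⟨(ContinuousLinearEquiv.unitsEquiv ℝ E).symm e, rfl⟩

/-- If `dT = T A` and `T` is invertible, then `d(T⁻¹) = - A T⁻¹`. -/
theorem HasFDerivAt.inverse_of_mul [CompleteSpace E] {T : E → E →L[ℝ] E}
    {Γ : E →L[ℝ] E →L[ℝ] E} {x : E}
    (hT : HasFDerivAt T (ContinuousLinearMap.mul ℝ (E →L[ℝ] E) (T x) ∘L Γ) x)
    (hinv : (T x).IsInvertible) :
    HasFDerivAt (fun y ↦ (T y).inverse)
      (-((ContinuousLinearMap.mul ℝ (E →L[ℝ] E)).flip (T x).inverse ∘L Γ)) x := by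
  obtain ⟨u, hu⟩ := ContinuousLinearMap.isUnit_iff_isInvertible.2 hinv
  have h := hasFDerivAt_ringInverse (𝕜 := ℝ) u
  rw [hu] at h
  have h2 := h.comp x hT
  rw [ContinuousLinearMap.ringInverse_eq_inverse] at h2
  refine h2.congr_fderiv ?_
  have hui : (T x).inverse = (↑u⁻¹ : E →L[ℝ] E) := by
    rw [← ContinuousLinearMap.ringInverse_eq_inverse, ← hu, Ring.inverse_unit]
  rw [hui, ← hu]
  ext v w
  simp [ContinuousLinearMap.mulLeftRight_apply, ← mul_assoc]

theorem flat_of_eventually_fderiv_apply {Γ : E → E →L[ℝ] E →L[ℝ] E} {W : E → E →L[ℝ] E} {x : E}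
    (hΓ : DifferentiableAt ℝ Γ x)
    (hW : ∀ᶠ y in 𝓝 x, DifferentiableAt ℝ W y ∧ ∀ v u, fderiv ℝ W y v u = -Γ y v (W y u))
    (hinv : (W x).IsInvertible) (v w : E) :
    fderiv ℝ Γ x v w + Γ x v * Γ x w = fderiv ℝ Γ x w v + Γ x w * Γ x v := by
  refine flat_of_eventually_hasFDerivAt_mul hΓ (hW.mono fun y hy ↦ ?_)
    (ContinuousLinearMap.isUnit_iff_isInvertible.2 hinv) v w
  refine hy.1.hasFDerivAt.congr_fderiv ?_
  ext v u
  simp [hy.2]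

/-- The bilinear form `(v, w) ↦ D v w + Γ v ∘ Γ w`, whose antisymmetric part is the curvature of
a connection form `Γ` with derivative `D`. -/
noncomputable def curvatureForm (D : E →L[ℝ] E →L[ℝ] E →L[ℝ] E) (Γ : E →L[ℝ] E →L[ℝ] E) :
    E →L[ℝ] E →L[ℝ] E →L[ℝ] E :=
  D + (ContinuousLinearMap.mul ℝ (E →L[ℝ] E)).bilinearComp Γ Γ

end FlatForms

/-! ### Affine coordinates of a symmetric flat connection form -/

section FlatCoordinates

variable {E : Type*} [NormedAddCommGroup E] [NormedSpace ℝ E]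

/-- Bootstrapping: if `Φ` is of class `C^k`, so is its derivative `Φ A`, hence `Φ` is of class
`C^(k+1)`. -/
theorem ContDiffOn.of_hasFDerivAt_mul {𝔸 : Type*} [NormedRing 𝔸] [NormedAlgebra ℝ 𝔸]
    {A : E → E →L[ℝ] 𝔸} {Φ : E → 𝔸} {s : Set E} (hs : IsOpen s) (hA : ContDiffOn ℝ ∞ A s)
    (hΦ : ∀ x ∈ s, HasFDerivAt Φ (ContinuousLinearMap.mul ℝ 𝔸 (Φ x) ∘L A x) x) :
    ContDiffOn ℝ ∞ Φ s := by
  rw [contDiffOn_infty]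
  intro k
  induction k with
  | zero =>
    exact contDiffOn_zero.2 fun x hx ↦ (hΦ x hx).continuousAt.continuousWithinAt
  | succ k ih =>
    push_cast
    rw [contDiffOn_succ_iff_fderiv_of_isOpen hs]
    refine ⟨fun x hx ↦ (hΦ x hx).differentiableAt.differentiableWithinAt, by simp, ?_⟩
    have : ContDiffOn ℝ k (fun x ↦ ContinuousLinearMap.mul ℝ 𝔸 (Φ x) ∘L A x) s :=
      ((ContinuousLinearMap.mul ℝ 𝔸).contDiff.comp_contDiffOn ih).clm_comp
        (contDiffOn_infty.1 hA k)
    exact this.congr fun x hx ↦ (hΦ x hx).fderiv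

/-- Around each point, a symmetric flat connection form admits coordinates `f` whose differential
solves `d(Df) = Df ∘ Γ`. -/
theorem exists_coordinates_of_flat [CompleteSpace E] {Γ : E → E →L[ℝ] E →L[ℝ] E} {U : Set E}
    (hU : IsOpen U) {x₀ : E} (hx₀ : x₀ ∈ U) (hΓ : ContDiffOn ℝ ∞ Γ U)
    (hsymm : ∀ x ∈ U, ∀ v w, Γ x v w = Γ x w v)
    (hflat : ∀ x ∈ U, ∀ v w, fderiv ℝ Γ x v w + Γ x v * Γ x w =
      fderiv ℝ Γ x w v + Γ x w * Γ x v) :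
    ∃ f : OpenPartialHomeomorph E E, x₀ ∈ f.source ∧ f.source ⊆ U ∧
      ContDiffOn ℝ ∞ f f.source ∧ ContDiffOn ℝ ∞ f.symm f.target ∧
      ∀ x ∈ f.source, (fderiv ℝ f x).IsInvertible ∧
        HasFDerivAt (fderiv ℝ f)
          (ContinuousLinearMap.mul ℝ (E →L[ℝ] E) (fderiv ℝ f x) ∘L Γ x) x := by
  obtain ⟨r₁, hr₁, Φ, hΦ0, hΦ₁⟩ := exists_hasFDerivAt_mul_of_flat
    ((contDiffOn_infty.1 hΓ 2).contDiffAt (hU.mem_nhds hx₀))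
    (Filter.mem_of_superset (hU.mem_nhds hx₀) hflat)
  obtain ⟨r₂, hr₂, hrU⟩ := Metric.isOpen_iff.1 hU x₀ hx₀
  obtain ⟨B, hB, hxB, hBc, hBU, hΦ⟩ : ∃ B : Set E, IsOpen B ∧ x₀ ∈ B ∧ Convex ℝ B ∧ B ⊆ U ∧
      ∀ x ∈ B, HasFDerivAt Φ (ContinuousLinearMap.mul ℝ (E →L[ℝ] E) (Φ x) ∘L Γ x) x :=
    ⟨ball x₀ (min r₁ r₂), isOpen_ball, mem_ball_self (lt_min hr₁ hr₂), convex_ball _ _,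
      (ball_subset_ball (min_le_right _ _)).trans hrU,
      fun x hx ↦ hΦ₁ x (ball_subset_ball (min_le_left _ _) hx)⟩
  have hΦs : ContDiffOn ℝ ∞ Φ B := ContDiffOn.of_hasFDerivAt_mul hB (hΓ.mono hBU) hΦ
  -- Poincaré lemma on a convex set: `DΦ v w = Φ (Γ v w)` is symmetric because `Γ` is, so `Φ` is the
  -- differential of some `g`.
  obtain ⟨g, hg⟩ := hBc.exists_forall_hasFDerivAt_of_fderiv_symmetric hB
    (fun x hx ↦ (hΦ x hx).differentiableAt.differentiableWithinAt) (fun x hx v w ↦ by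
      rw [(hΦ x hx).fderiv]
      simp [hsymm x (hBU hx) v w])
  have hgs : ContDiffOn ℝ ∞ g B :=
    (contDiffOn_infty_iff_fderiv_of_isOpen hB).2
      ⟨fun x hx ↦ (hg x hx).differentiableAt.differentiableWithinAt,
        hΦs.congr fun x hx ↦ (hg x hx).fderiv⟩
  have hgx : HasFDerivAt g ((ContinuousLinearEquiv.refl ℝ E : E ≃L[ℝ] E) : E →L[ℝ] E) x₀ := by
    have := hg x₀ hxB
    rw [hΦ0] at this
    exact this
  have hgc : ContDiffAt ℝ ∞ g x₀ := hgs.contDiffAt (hB.mem_nhds hxB)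
  -- Shrinking to where `Φ` is invertible makes the inverse map smooth on the whole target, not just
  -- at the image of `x₀`.
  have hS : IsOpen (B ∩ Φ ⁻¹' {T | IsUnit T}) :=
    hΦs.continuousOn.isOpen_inter_preimage hB Units.isOpen
  set f := (hgc.toOpenPartialHomeomorph g hgx (by simp)).restrOpen _ hS with hf
  have hfg : (f : E → E) = g := rfl
  have hsrc : f.source ⊆ B ∩ Φ ⁻¹' {T | IsUnit T} := inter_subset_right
  have hD : ∀ x ∈ f.source, fderiv ℝ f x = Φ x := fun x hx ↦ (hg x (hsrc hx).1).fderiv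
  have hI : ∀ x ∈ f.source, (fderiv ℝ f x).IsInvertible := fun x hx ↦ by
    rw [hD x hx]; exact ContinuousLinearMap.isUnit_iff_isInvertible.1 (hsrc hx).2
  refine ⟨f, ⟨hgc.mem_toOpenPartialHomeomorph_source hgx (by simp), hxB, by simp [hΦ0]⟩,
    fun x hx ↦ hBU (hsrc hx).1, hgs.mono fun x hx ↦ (hsrc hx).1, fun y hy ↦ ?_,
    fun x hx ↦ ⟨hI x hx, ?_⟩⟩
  · have hx := f.map_target hy
    obtain ⟨e, he⟩ := hI _ hx
    refine (f.contDiffAt_symm hy (f₀' := e) ?_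
      (hgs.contDiffAt (hB.mem_nhds (hsrc hx).1))).contDiffWithinAt
    rw [he, hD _ hx]
    exact hg _ (hsrc hx).1
  · rw [hD x hx]
    exact (hΦ x (hsrc hx).1).congr_of_eventuallyEq
      (Filter.mem_of_superset (f.open_source.mem_nhds hx) hD)

end FlatCoordinates

/-! ### Charts, coordinate fields and changes of chart -/

namespace AffineManifold

theorem chartPartial_congr {n : ℕ} {M : Type*} [TopologicalSpace M]
    {φ : OpenPartialHomeomorph M (EuclideanSpace ℝ (Fin n))} {q : M} (hq : q ∈ φ.source) (p : Fin n)
    {f g : M → ℝ} (h : ∀ r ∈ φ.source, f r = g r) : chartPartial φ p f q = chartPartial φ p g q := by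
  have he : (fun y ↦ f (φ.symm y)) =ᶠ[𝓝 (φ q)] fun y ↦ g (φ.symm y) := by
    filter_upwards [φ.open_target.mem_nhds (φ.map_source hq)] with y hy using h _ (φ.map_target hy)
  rw [chartPartial, chartPartial, he.fderiv_eq]

section Charts

variable {n : ℕ} {M : Type*} [TopologicalSpace M] [ChartedSpace (EuclideanSpace ℝ (Fin n)) M]

/-- The differential of a chart, with values in the model space. -/
noncomputable def chartDeriv (φ : OpenPartialHomeomorph M (EuclideanSpace ℝ (Fin n))) (p : M) :
    TangentSpace (𝓡 n) p →L[ℝ] EuclideanSpace ℝ (Fin n) :=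
  mfderiv (𝓡 n) (𝓡 n) φ p

theorem coordComp_eq (φ : OpenPartialHomeomorph M (EuclideanSpace ℝ (Fin n))) (l : Fin n) (p : M)
    (v : TangentSpace (𝓡 n) p) : coordComp φ l p v = chartDeriv φ p v l := rfl

theorem sum_smul_stdVec (v : EuclideanSpace ℝ (Fin n)) : ∑ i, v i • stdVec i = v := by
  ext k
  simp [stdVec, Pi.single_apply]

variable {φ ψ : OpenPartialHomeomorph M (EuclideanSpace ℝ (Fin n))}

theorem mdifferentiable_of_mem_maximalAtlas (hφ : φ ∈ IsManifold.maximalAtlas (𝓡 n) ∞ M) :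
    φ.MDifferentiable (𝓡 n) (𝓡 n) := by
  have hφ1 := IsManifold.maximalAtlas_subset_of_le (I := 𝓡 n) (M := M)
    (m := 1) (n := ∞) (by simp) hφ
  exact
    ⟨fun x hx ↦ (mdifferentiableAt_of_mem_maximalAtlas hφ1 hx).mdifferentiableWithinAt,
      fun x hx ↦ (mdifferentiableAt_symm_of_mem_maximalAtlas hφ1 hx).mdifferentiableWithinAt⟩

theorem isInvertible_chartDeriv (hφ : φ ∈ IsManifold.maximalAtlas (𝓡 n) ∞ M) {p : M}
    (hp : p ∈ φ.source) : (chartDeriv φ p).IsInvertible := by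
  exact ⟨(mdifferentiable_of_mem_maximalAtlas hφ).mfderiv hp, rfl⟩

theorem coordField_eq (i : Fin n) (p : M) :
    coordField φ i p = (chartDeriv φ p).inverse (stdVec i) := rfl

theorem chartDeriv_coordField (hφ : φ ∈ IsManifold.maximalAtlas (𝓡 n) ∞ M) {p : M}
    (hp : p ∈ φ.source) (i : Fin n) : chartDeriv φ p (coordField φ i p) = stdVec i :=
  (isInvertible_chartDeriv hφ hp).self_apply_inverse _

theorem contMDiffAt_coordField [IsManifold (𝓡 n) ∞ M]
    (hφ : φ ∈ IsManifold.maximalAtlas (𝓡 n) ∞ M) {p : M} (hp : p ∈ φ.source) (i : Fin n) :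
    ContMDiffAt (𝓡 n) (𝓡 n).tangent ∞ (T% (coordField φ i)) p := by
  have hc : ContMDiffAt (𝓡 n) (𝓡 n).tangent ∞
      (fun y : EuclideanSpace ℝ (Fin n) ↦
        (⟨y, stdVec i⟩ : TangentBundle (𝓡 n) (EuclideanSpace ℝ (Fin n)))) (φ p) :=
    contMDiffAt_vectorSpace_iff_contDiffAt.2 contDiffAt_const
  exact hc.mpullback_vectorField_preimage (contMDiffAt_of_mem_maximalAtlas hφ hp)
    (isInvertible_chartDeriv hφ hp) (by simp)

/-- The components of `Z` are its pullback by `φ.symm`: that pullback uses the inverse of the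
differential of `φ.symm`, which on the target is the differential of `φ`. -/
theorem contDiffAt_chartDeriv_section [IsManifold (𝓡 n) ∞ M]
    (hφ : φ ∈ IsManifold.maximalAtlas (𝓡 n) ∞ M) {p : M} (hp : p ∈ φ.source)
    {Z : Π p : M, TangentSpace (𝓡 n) p}
    (hZ : ContMDiffAt (𝓡 n) (𝓡 n).tangent ∞ (T% Z) p) :
    ContDiffAt ℝ ∞ (fun y ↦ chartDeriv φ (φ.symm y) (Z (φ.symm y))) (φ p) := by
  have h := mdifferentiable_of_mem_maximalAtlas hφ
  have hpt := φ.map_source hp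
  have hZ' : ContMDiffAt (𝓡 n) (𝓡 n).tangent ∞ (T% Z) (φ.symm (φ p)) := by rwa [φ.left_inv hp]
  have h1 := hZ'.mpullback_vectorField_preimage (n := ∞)
    (contMDiffAt_symm_of_mem_maximalAtlas hφ hpt)
    ⟨h.symm.mfderiv hpt, rfl⟩ (by simp)
  rw [contMDiffAt_vectorSpace_iff_contDiffAt] at h1
  refine h1.congr_of_eventuallyEq ?_
  filter_upwards [φ.open_target.mem_nhds hpt] with y hy
  have hinv : (mfderiv (𝓡 n) (𝓡 n) φ.symm y).IsInvertible := ⟨h.symm.mfderiv hy, rfl⟩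
  have := h.comp_symm_deriv hy
  have h2 := DFunLike.congr_fun this
    ((mfderiv (𝓡 n) (𝓡 n) φ.symm y).inverse (Z (φ.symm y)))
  rw [ContinuousLinearMap.comp_apply, hinv.self_apply_inverse] at h2
  exact h2

/-- The chain rule for a change of charts. -/
theorem chartDeriv_change (hφ : φ ∈ IsManifold.maximalAtlas (𝓡 n) ∞ M) {p : M}
    (hp : p ∈ φ.source) {f : EuclideanSpace ℝ (Fin n) → EuclideanSpace ℝ (Fin n)}
    (hf : DifferentiableAt ℝ f (φ p)) (hfψ : ∀ᶠ q in 𝓝 p, ψ q = f (φ q)) :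
    chartDeriv ψ p = fderiv ℝ f (φ p) ∘L chartDeriv φ p := by
  have h1 := ((mdifferentiable_of_mem_maximalAtlas hφ).mdifferentiableAt hp).hasMFDerivAt
  have h2 := (hf.hasFDerivAt.hasMFDerivAt.comp p h1).congr_of_eventuallyEq hfψ
  exact h2.mfderiv

theorem isInvertible_fderiv_change (hφ : φ ∈ IsManifold.maximalAtlas (𝓡 n) ∞ M)
    (hψ : ψ ∈ IsManifold.maximalAtlas (𝓡 n) ∞ M) {p : M} (hp : p ∈ φ.source)
    (hpψ : p ∈ ψ.source) {f : EuclideanSpace ℝ (Fin n) → EuclideanSpace ℝ (Fin n)}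
    (hf : DifferentiableAt ℝ f (φ p)) (hfψ : ∀ᶠ q in 𝓝 p, ψ q = f (φ q)) :
    (fderiv ℝ f (φ p)).IsInvertible := by
  have hch := chartDeriv_change hφ hp hf hfψ
  obtain ⟨e, he⟩ := isInvertible_chartDeriv hφ hp
  obtain ⟨e', he'⟩ := isInvertible_chartDeriv hψ hpψ
  refine ⟨e.symm.trans e', ?_⟩
  ext1 w
  have := DFunLike.congr_fun hch (e.symm w)
  rw [← he, ← he'] at this
  simpa using this

end Charts

end AffineManifold

/-! ### The connection in a chart -/

namespace AffineManifold

section Connection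

variable {n : ℕ} {M : Type*} [TopologicalSpace M] [ChartedSpace (EuclideanSpace ℝ (Fin n)) M]
  [IsManifold (𝓡 n) ∞ M]
  {cov : CovariantDerivative (𝓡 n) (EuclideanSpace ℝ (Fin n)) (TangentSpace (𝓡 n) : M → Type _)}
  {φ ψ : OpenPartialHomeomorph M (EuclideanSpace ℝ (Fin n))}

theorem mdifferentiableAt_coordField (hφ : φ ∈ IsManifold.maximalAtlas (𝓡 n) ∞ M) {p : M}
    (hp : p ∈ φ.source) (i : Fin n) :
    MDifferentiableAt (𝓡 n) (𝓡 n).tangent (T% (coordField φ i)) p :=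
  (contMDiffAt_coordField hφ hp i).mdifferentiableAt (by simp)

/-- A global smooth field which agrees with a coordinate field near a given point. -/
theorem exists_contMDiff_eventuallyEq_coordField [T2Space M]
    (hφ : φ ∈ IsManifold.maximalAtlas (𝓡 n) ∞ M) {p : M} (hp : p ∈ φ.source) (i : Fin n) :
    ∃ Z : Π p : M, TangentSpace (𝓡 n) p,
      ContMDiff (𝓡 n) (𝓡 n).tangent ∞ (T% Z) ∧ ∀ᶠ q in 𝓝 p, Z q = coordField φ i q := by
  obtain ⟨f, -, hf⟩ := (SmoothBumpFunction.nhds_basis_tsupport (I := 𝓡 n) p).mem_iff.1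
    (φ.open_source.mem_nhds hp)
  refine ⟨fun q ↦ f q • coordField φ i q, fun q ↦ ?_, ?_⟩
  · by_cases hq : q ∈ tsupport f
    · exact f.contMDiffAt.smul_section (contMDiffAt_coordField hφ (hf hq) i)
    · have h0 : ContMDiffAt (𝓡 n) (𝓡 n).tangent ∞ (Bundle.zeroSection
          (EuclideanSpace ℝ (Fin n)) (TangentSpace (𝓡 n) : M → Type _)) q :=
        (Bundle.contMDiff_zeroSection ℝ (TangentSpace (𝓡 n) : M → Type _)).contMDiffAt
      refine h0.congr_of_eventuallyEq ?_
      filter_upwards [(isClosed_tsupport f).isOpen_compl.mem_nhds hq] with r hr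
      simp [image_eq_zero_of_notMem_tsupport hr, Bundle.zeroSection]
  · filter_upwards [f.eventuallyEq_one] with q hq
    simp [hq]

/-- The smoothness hypothesis is applied to a globally smooth field with the same germ as the
coordinate field; this suffices because a covariant derivative depends only on the germ. -/
theorem contMDiffAt_cov_coordField [T2Space M] (hsmooth : cov.ContMDiffCovariantDerivative ∞)
    (hφ : φ ∈ IsManifold.maximalAtlas (𝓡 n) ∞ M) {p : M} (hp : p ∈ φ.source) (i j : Fin n) :
    ContMDiffAt (𝓡 n) (𝓡 n).tangent ∞
      (T% (fun q ↦ cov (coordField φ j) q (coordField φ i q))) p := by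
  obtain ⟨Z, hZ, hZφ⟩ := exists_contMDiff_eventuallyEq_coordField hφ hp j
  have h1 := (hsmooth.contMDiff.contMDiff (σ := Z) (by simpa using hZ.contMDiffOn)).contMDiffAt
    (x := p) univ_mem
  have h2 := h1.clm_bundle_apply (contMDiffAt_coordField hφ hp i)
  refine h2.congr_of_eventuallyEq ?_
  filter_upwards [hZφ.eventually_nhds, φ.open_source.mem_nhds hp] with q hq hqs
  have h3 := cov.isCovariantDerivativeOnUniv.congr_of_eventuallyEq
    (mdifferentiableAt_coordField hφ hqs j) ((hZ q).mdifferentiableAt (by simp)) univ_mem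
    (hq.mono fun _ h ↦ h.symm)
  exact congrArg (fun L ↦ (⟨q, L (coordField φ i q)⟩ : TangentBundle (𝓡 n) M)) h3

theorem contDiffOn_christoffel [T2Space M] (hsmooth : cov.ContMDiffCovariantDerivative ∞)
    (hφ : φ ∈ IsManifold.maximalAtlas (𝓡 n) ∞ M) (l i j : Fin n) :
    ContDiffOn ℝ ∞ (fun y ↦ christoffel cov φ l i j (φ.symm y)) φ.target := by
  intro y hy
  have h := contDiffAt_chartDeriv_section hφ (φ.map_target hy)
    (contMDiffAt_cov_coordField hsmooth hφ (φ.map_target hy) i j)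
  rw [φ.right_inv hy] at h
  exact ((EuclideanSpace.proj l : EuclideanSpace ℝ (Fin n) →L[ℝ] ℝ).contDiff.contDiffAt.comp y
    h).contDiffWithinAt

theorem lieBracketWithin_const_const {E : Type*} [NormedAddCommGroup E] [NormedSpace ℝ E]
    (v w : E) (s : Set E) :
    VectorField.lieBracketWithin ℝ (fun _ ↦ v) (fun _ ↦ w) s = 0 := by
  ext y
  simp [VectorField.lieBracketWithin]

/-- Coordinate fields are pullbacks of constant fields, and pullback commutes with the Lie bracket,
so their bracket vanishes; zero torsion then makes `∇_{∂ᵢ} ∂ⱼ` symmetric. -/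
theorem christoffel_symm (htorsion : cov.torsion = 0)
    (hφ : φ ∈ IsManifold.maximalAtlas (𝓡 n) ∞ M) {p : M} (hp : p ∈ φ.source) (l i j : Fin n) :
    christoffel cov φ l i j p = christoffel cov φ l j i p := by
  have h := cov.torsion_eq_zero_iff.1 htorsion (mdifferentiableAt_coordField hφ hp i)
    (mdifferentiableAt_coordField hφ hp j)
  have h2 : (2 : ℕ∞ω) ≤ ∞ := WithTop.coe_le_coe.2 le_top
  have : IsManifold (𝓡 n) (minSmoothness ℝ 2) M := by
    rw [minSmoothness_of_isRCLikeNormedField]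
    exact IsManifold.of_le (n := ∞) h2
  let V (i : Fin n) (y : EuclideanSpace ℝ (Fin n)) : TangentSpace (𝓡 n) y := stdVec i
  have hc : ∀ i : Fin n, MDifferentiableAt (𝓡 n) (𝓡 n).tangent (T% (V i)) (φ p) := fun i ↦
    (contMDiffAt_vectorSpace_iff_contDiffAt.2
      (contDiffAt_const (n := 1))).mdifferentiableAt one_ne_zero
  have hb := VectorField.mpullback_mlieBracket (n := ∞) (hc i) (hc j)
    (contMDiffAt_of_mem_maximalAtlas hφ hp)
    (by rw [minSmoothness_of_isRCLikeNormedField]; exact h2)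
  have h0 : VectorField.mlieBracket (𝓡 n) (V i) (V j) = 0 := by
    rw [← VectorField.mlieBracketWithin_univ, VectorField.mlieBracketWithin_eq_lieBracketWithin]
    exact lieBracketWithin_const_const _ _ _
  rw [h0] at hb
  have h1 : cov (coordField φ j) p (coordField φ i p) =
      cov (coordField φ i) p (coordField φ j p) := by
    rw [← sub_eq_zero, h]
    refine hb.symm.trans ?_
    simp [VectorField.mpullback_apply]
  simp only [christoffel, h1]

variable (cov φ) in
/-- The Christoffel symbols of a chart, assembled into a bilinear-map valued function on the model
space. -/
noncomputable def connForm (y : EuclideanSpace ℝ (Fin n)) :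
    EuclideanSpace ℝ (Fin n) →L[ℝ] EuclideanSpace ℝ (Fin n) →L[ℝ] EuclideanSpace ℝ (Fin n) :=
  ∑ l, ∑ i, ∑ j, christoffel cov φ l i j (φ.symm y) •
    (EuclideanSpace.proj i : EuclideanSpace ℝ (Fin n) →L[ℝ] ℝ).smulRight
      ((EuclideanSpace.proj j : EuclideanSpace ℝ (Fin n) →L[ℝ] ℝ).smulRight (stdVec l))

theorem connForm_stdVec (y : EuclideanSpace ℝ (Fin n)) (l i j : Fin n) :
    connForm cov φ y (stdVec i) (stdVec j) l = christoffel cov φ l i j (φ.symm y) := by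
  simp [connForm, stdVec, Pi.single_apply, _root_.sum_apply]

theorem contDiffOn_connForm [T2Space M] (hsmooth : cov.ContMDiffCovariantDerivative ∞)
    (hφ : φ ∈ IsManifold.maximalAtlas (𝓡 n) ∞ M) :
    ContDiffOn ℝ ∞ (connForm cov φ) φ.target := by
  refine contDiffOn_clm_apply.2 fun v ↦ contDiffOn_clm_apply.2 fun w ↦ ?_
  have h : ∀ y, connForm cov φ y v w =
      ∑ l, ∑ i, ∑ j, christoffel cov φ l i j (φ.symm y) • v i • w j • stdVec l := fun y ↦ by
    simp [connForm, _root_.sum_apply]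
  simp only [h]
  exact ContDiffOn.sum fun l _ ↦ ContDiffOn.sum fun i _ ↦ ContDiffOn.sum fun j _ ↦
    (contDiffOn_christoffel hsmooth hφ l i j).smul contDiffOn_const

theorem ext_stdVec₂ {F : Type*} [AddCommGroup F] [Module ℝ F] [TopologicalSpace F]
    [IsTopologicalAddGroup F] [ContinuousSMul ℝ F]
    {A B : EuclideanSpace ℝ (Fin n) →L[ℝ] EuclideanSpace ℝ (Fin n) →L[ℝ] F}
    (h : ∀ i j, A (stdVec i) (stdVec j) = B (stdVec i) (stdVec j)) : A = B := by
  ext v w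
  rw [← sum_smul_stdVec v, ← sum_smul_stdVec w]
  simp [h, _root_.sum_apply]

theorem chartDeriv_cov_coordField (hφ : φ ∈ IsManifold.maximalAtlas (𝓡 n) ∞ M) {p : M}
    (hp : p ∈ φ.source) (v : TangentSpace (𝓡 n) p) (j : Fin n) :
    chartDeriv φ p (cov (coordField φ j) p v) =
      connForm cov φ (φ p) (chartDeriv φ p v) (stdVec j) := by
  have hv : v = ∑ i, (chartDeriv φ p v) i • coordField φ i p := by
    apply (isInvertible_chartDeriv hφ hp).injective
    simp [chartDeriv_coordField hφ hp, sum_smul_stdVec]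
  have hb : ∀ i, chartDeriv φ p (cov (coordField φ j) p (coordField φ i p)) =
      connForm cov φ (φ p) (stdVec i) (stdVec j) := by
    intro i
    ext l
    rw [connForm_stdVec, φ.left_inv hp]
    rfl
  conv_lhs => rw [hv]
  conv_rhs => rw [← sum_smul_stdVec (chartDeriv φ p v)]
  simp [hb, _root_.sum_apply]

/-- The covariant derivative of a vector field in terms of its components in a chart. -/
theorem chartDeriv_cov (hφ : φ ∈ IsManifold.maximalAtlas (𝓡 n) ∞ M) {p : M} (hp : p ∈ φ.source)
    {Z : Π p : M, TangentSpace (𝓡 n) p}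
    (hZ : MDifferentiableAt (𝓡 n) (𝓡 n).tangent (T% Z) p)
    {z : EuclideanSpace ℝ (Fin n) → EuclideanSpace ℝ (Fin n)}
    {z' : EuclideanSpace ℝ (Fin n) →L[ℝ] EuclideanSpace ℝ (Fin n)}
    (hz : HasFDerivAt z z' (φ p)) (hZz : ∀ᶠ q in 𝓝 p, chartDeriv φ q (Z q) = z (φ q))
    (v : TangentSpace (𝓡 n) p) :
    chartDeriv φ p (cov Z p v) =
      z' (chartDeriv φ p v) + connForm cov φ (φ p) (chartDeriv φ p v) (z (φ p)) := by
  have hm := ((mdifferentiable_of_mem_maximalAtlas hφ).mdifferentiableAt hp).hasMFDerivAt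
  have hg : ∀ j, HasMFDerivAt (𝓡 n) 𝓘(ℝ, ℝ) (fun q ↦ z (φ q) j) p
      (((EuclideanSpace.proj j : EuclideanSpace ℝ (Fin n) →L[ℝ] ℝ) ∘L z') ∘L chartDeriv φ p) :=
    fun j ↦ (((EuclideanSpace.proj j : EuclideanSpace ℝ (Fin n) →L[ℝ] ℝ).hasFDerivAt.comp _
      hz).hasMFDerivAt).comp p hm
  have hsec : ∀ j, MDifferentiableAt (𝓡 n) (𝓡 n).tangent
      (T% ((fun q ↦ z (φ q) j) • coordField φ j)) p := fun j ↦
    (hg j).mdifferentiableAt.smul_section (mdifferentiableAt_coordField hφ hp j)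
  -- Differentiability of the partial sums is carried through the induction, since additivity of
  -- `cov` requires it.
  have hsum : ∀ s : Finset (Fin n),
      MDifferentiableAt (𝓡 n) (𝓡 n).tangent
        (T% (∑ j ∈ s, (fun q ↦ z (φ q) j) • coordField φ j)) p ∧
      cov (∑ j ∈ s, (fun q ↦ z (φ q) j) • coordField φ j) p =
        ∑ j ∈ s, cov ((fun q ↦ z (φ q) j) • coordField φ j) p := by
    intro s
    classical
    induction s using Finset.induction_on with
    | empty =>
      simp only [Finset.sum_empty]
      exact ⟨Bundle.mdifferentiableAt_zeroSection .., by simp⟩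
    | insert a s ha ih =>
      rw [Finset.sum_insert ha, Finset.sum_insert ha, ← ih.2]
      exact ⟨mdifferentiableAt_add_section (hsec a) ih.1,
        cov.isCovariantDerivativeOnUniv.add (hsec a) ih.1⟩
  have hcongr : cov Z p = cov (∑ j, (fun q ↦ z (φ q) j) • coordField φ j) p := by
    refine cov.isCovariantDerivativeOnUniv.congr_of_eventuallyEq hZ (hsum _).1 univ_mem ?_
    filter_upwards [hZz, φ.open_source.mem_nhds hp] with q hq hqs
    apply (isInvertible_chartDeriv hφ hqs).injective
    rw [hq]
    simp [Finset.sum_apply, chartDeriv_coordField hφ hqs, sum_smul_stdVec]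
  have hterm : ∀ j, chartDeriv φ p (cov ((fun q ↦ z (φ q) j) • coordField φ j) p v) =
      z (φ p) j • connForm cov φ (φ p) (chartDeriv φ p v) (stdVec j) +
        z' (chartDeriv φ p v) j • stdVec j := by
    intro j
    rw [cov.isCovariantDerivativeOnUniv.leibniz (mdifferentiableAt_coordField hφ hp j)
      (hg j).mdifferentiableAt]
    have hd : mvfderiv (𝓡 n) (fun q ↦ z (φ q) j) p v = z' (chartDeriv φ p v) j := by
      rw [mvfderiv, (hg j).mfderiv]
      rfl
    simp [chartDeriv_cov_coordField hφ hp, chartDeriv_coordField hφ hp, hd]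
  rw [hcongr, (hsum _).2, _root_.sum_apply, map_sum, Finset.sum_congr rfl fun j _ ↦ hterm j,
    Finset.sum_add_distrib, sum_smul_stdVec, add_comm]
  congr 1
  conv_rhs => rw [← sum_smul_stdVec (z (φ p))]
  simp

/-- The covariant derivative of a coordinate field of one chart, seen in another chart. -/
theorem chartDeriv_cov_coordField_change (hφ : φ ∈ IsManifold.maximalAtlas (𝓡 n) ∞ M)
    (hψ : ψ ∈ IsManifold.maximalAtlas (𝓡 n) ∞ M) {p : M} (hp : p ∈ φ.source)
    (hpψ : p ∈ ψ.source) {f : EuclideanSpace ℝ (Fin n) → EuclideanSpace ℝ (Fin n)}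
    (hf : ∀ᶠ y in 𝓝 (φ p), DifferentiableAt ℝ f y) (hfψ : ∀ᶠ q in 𝓝 p, ψ q = f (φ q))
    {T' : EuclideanSpace ℝ (Fin n) →L[ℝ] EuclideanSpace ℝ (Fin n) →L[ℝ] EuclideanSpace ℝ (Fin n)}
    (hT : HasFDerivAt (fun y ↦ (fderiv ℝ f y).inverse) T' (φ p)) (a : Fin n)
    (v : TangentSpace (𝓡 n) p) :
    chartDeriv φ p (cov (coordField ψ a) p v) = T' (chartDeriv φ p v) (stdVec a) +
      connForm cov φ (φ p) (chartDeriv φ p v) ((fderiv ℝ f (φ p)).inverse (stdVec a)) := by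
  -- In the chart `φ`, the `a`-th coordinate field of `ψ` has components `(Df)⁻¹ eₐ`.
  have hz : HasFDerivAt (fun y ↦ (fderiv ℝ f y).inverse (stdVec a)) (T'.flip (stdVec a)) (φ p) := by
    simpa using hT.clm_apply (hasFDerivAt_const (stdVec a) (φ p))
  refine chartDeriv_cov hφ hp (mdifferentiableAt_coordField hψ hpψ a) hz ?_ v
  filter_upwards [(φ.continuousAt hp).eventually hf, hfψ.eventually_nhds,
    φ.open_source.mem_nhds hp, ψ.open_source.mem_nhds hpψ] with q hfq hfψq hqφ hqψ
  have hch := chartDeriv_change hφ hqφ hfq hfψq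
  have hinv := isInvertible_fderiv_change hφ hψ hqφ hqψ hfq hfψq
  apply hinv.injective
  rw [hinv.self_apply_inverse, ← ContinuousLinearMap.comp_apply, ← hch,
    chartDeriv_coordField hψ hqψ]

end Connection

end AffineManifold

/-! ### Curvature and charts with vanishing Christoffel symbols -/

namespace AffineManifold

section Curvature

variable {n : ℕ} {M : Type*} [TopologicalSpace M] [ChartedSpace (EuclideanSpace ℝ (Fin n)) M]
  [IsManifold (𝓡 n) ∞ M]
  {cov : CovariantDerivative (𝓡 n) (EuclideanSpace ℝ (Fin n)) (TangentSpace (𝓡 n) : M → Type _)}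
  {φ ψ : OpenPartialHomeomorph M (EuclideanSpace ℝ (Fin n))}

theorem chartPartial_christoffel [T2Space M] (hsmooth : cov.ContMDiffCovariantDerivative ∞)
    (hφ : φ ∈ IsManifold.maximalAtlas (𝓡 n) ∞ M) {q : M} (hq : q ∈ φ.source) (l p i j : Fin n) :
    chartPartial φ p (christoffel cov φ l i j) q =
      fderiv ℝ (connForm cov φ) (φ q) (stdVec p) (stdVec i) (stdVec j) l := by
  have hd : HasFDerivAt (connForm cov φ) (fderiv ℝ (connForm cov φ) (φ q)) (φ q) :=
    ((((contDiffOn_connForm hsmooth hφ).contDiffAt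
      (φ.open_target.mem_nhds (φ.map_source hq))).differentiableAt (by simp))).hasFDerivAt
  have h1 : HasFDerivAt (fun y ↦ connForm cov φ y (stdVec i) (stdVec j) l) _ (φ q) :=
    (EuclideanSpace.proj l : EuclideanSpace ℝ (Fin n) →L[ℝ] ℝ).hasFDerivAt.comp (φ q)
      ((hd.clm_apply (hasFDerivAt_const (stdVec i) _)).clm_apply
        (hasFDerivAt_const (stdVec j) _))
  simp only [connForm_stdVec] at h1
  rw [chartPartial, h1.fderiv]
  simp

theorem sum_christoffel_mul {q : M} (hq : q ∈ φ.source) (l j k i : Fin n) :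
    ∑ s, christoffel cov φ l j s q * christoffel cov φ s k i q =
      connForm cov φ (φ q) (stdVec j) (connForm cov φ (φ q) (stdVec k) (stdVec i)) l := by
  conv_rhs => rw [← sum_smul_stdVec (connForm cov φ (φ q) (stdVec k) (stdVec i))]
  simp [connForm_stdVec, φ.left_inv hq, mul_comm]

/-- All components of the curvature vanish iff the curvature form of `connForm` does. -/
theorem curvature_eq_zero_iff [T2Space M] (hsmooth : cov.ContMDiffCovariantDerivative ∞)
    (htorsion : cov.torsion = 0)
    (hφ : φ ∈ IsManifold.maximalAtlas (𝓡 n) ∞ M) {q : M} (hq : q ∈ φ.source) :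
    (∀ l i j k, curvature cov φ l i j k q = 0) ↔
      ∀ v w, fderiv ℝ (connForm cov φ) (φ q) v w +
          connForm cov φ (φ q) v * connForm cov φ (φ q) w =
        fderiv ℝ (connForm cov φ) (φ q) w v +
          connForm cov φ (φ q) w * connForm cov φ (φ q) v := by
  have hsymm := fun l i j ↦ fun r (hr : r ∈ φ.source) ↦
    christoffel_symm (n := n) htorsion hφ hr l i j
  have key : ∀ l i j k, curvature cov φ l i j k q =
      (fderiv ℝ (connForm cov φ) (φ q) (stdVec j) (stdVec k) +
          connForm cov φ (φ q) (stdVec j) * connForm cov φ (φ q) (stdVec k)) (stdVec i) l -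
        (fderiv ℝ (connForm cov φ) (φ q) (stdVec k) (stdVec j) +
          connForm cov φ (φ q) (stdVec k) * connForm cov φ (φ q) (stdVec j)) (stdVec i) l := by
    intro l i j k
    -- The curvature components carry the index `i` of the differentiated field in the first lower
    -- slot, while composing endomorphisms needs it in the last one; torsion-freeness allows the
    -- swap.
    rw [curvature, chartPartial_congr hq j (hsymm l i k), chartPartial_congr hq k (hsymm l i j)]
    simp only [hsymm _ i _ q hq, chartPartial_christoffel hsmooth hφ hq, sum_christoffel_mul hq,
      _root_.add_apply, mul_apply_eq_comp, PiLp.add_apply]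
    ring
  constructor
  · intro h v w
    have hD : curvatureForm (fderiv ℝ (connForm cov φ) (φ q)) (connForm cov φ (φ q)) =
        (curvatureForm (fderiv ℝ (connForm cov φ) (φ q)) (connForm cov φ (φ q))).flip := by
      refine ext_stdVec₂ fun j k ↦ ?_
      ext1 u
      rw [← sum_smul_stdVec u]
      simp only [map_sum, map_smul]
      refine Finset.sum_congr rfl fun i _ ↦ congrArg _ ?_
      ext l
      have := h l i j k
      rw [key, sub_eq_zero] at this
      exact this
    exact DFunLike.congr_fun (DFunLike.congr_fun hD v) w
  · intro h l i j k
    rw [key, h, sub_self]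

/-- Turns vanishing Christoffel symbols into parallel coordinate fields, a condition that can be
computed in any other chart. -/
theorem cov_coordField_eq_zero_iff (hφ : φ ∈ IsManifold.maximalAtlas (𝓡 n) ∞ M) {q : M}
    (hq : q ∈ φ.source) :
    (∀ j, cov (coordField φ j) q = 0) ↔ ∀ l i j, christoffel cov φ l i j q = 0 := by
  refine ⟨fun h l i j ↦ by simp [christoffel, coordComp_eq, h], fun h j ↦ ?_⟩
  have h0 : connForm cov φ (φ q) = 0 := ext_stdVec₂ fun i j ↦ by
    ext l
    simp [connForm_stdVec, φ.left_inv hq, h]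
  ext1 v
  apply (isInvertible_chartDeriv hφ hq).injective
  rw [chartDeriv_cov_coordField hφ hq, h0]
  simp

theorem trans_mem_maximalAtlas (hφ : φ ∈ IsManifold.maximalAtlas (𝓡 n) ∞ M)
    {f : OpenPartialHomeomorph (EuclideanSpace ℝ (Fin n)) (EuclideanSpace ℝ (Fin n))}
    (hf : ContDiffOn ℝ ∞ f f.source) (hf' : ContDiffOn ℝ ∞ f.symm f.target) :
    φ.trans f ∈ IsManifold.maximalAtlas (𝓡 n) ∞ M := by
  refine OpenPartialHomeomorph.mem_maximalAtlas_of_contMDiffOn _ ?_ ?_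
  · exact hf.contMDiffOn.comp ((contMDiffOn_of_mem_maximalAtlas hφ).mono fun x hx ↦ hx.1)
      fun x hx ↦ hx.2
  · exact (contMDiffOn_symm_of_mem_maximalAtlas hφ).comp (hf'.contMDiffOn.mono fun x hx ↦ hx.1)
      fun x hx ↦ hx.2

/-- A torsion-free connection which is flat in some chart around `x` admits a chart around `x`
with vanishing Christoffel symbols. -/
theorem exists_chart_christoffel_eq_zero [T2Space M]
    (hsmooth : cov.ContMDiffCovariantDerivative ∞) (htorsion : cov.torsion = 0)
    (hφ : φ ∈ IsManifold.maximalAtlas (𝓡 n) ∞ M) {x : M} (hx : x ∈ φ.source)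
    (hR : ∀ q ∈ φ.source, ∀ l i j k, curvature cov φ l i j k q = 0) :
    ∃ ψ ∈ IsManifold.maximalAtlas (𝓡 n) ∞ M, x ∈ ψ.source ∧
      ∀ q ∈ ψ.source, ∀ i j k : Fin n, christoffel cov ψ i j k q = 0 := by
  obtain ⟨f, hxf, -, hf, hf', hder⟩ := exists_coordinates_of_flat φ.open_target (φ.map_source hx)
    (contDiffOn_connForm hsmooth hφ) (fun y hy v w ↦ by
      have : connForm cov φ y = (connForm cov φ y).flip := ext_stdVec₂ fun i j ↦ by
        ext l
        rw [ContinuousLinearMap.flip_apply, connForm_stdVec, connForm_stdVec,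
          christoffel_symm htorsion hφ (φ.map_target hy)]
      exact DFunLike.congr_fun (DFunLike.congr_fun this v) w)
    (fun y hy v w ↦ by
      have := (curvature_eq_zero_iff hsmooth htorsion hφ (φ.map_target hy)).1
        (hR _ (φ.map_target hy)) v w
      rwa [φ.right_inv hy] at this)
  have hψ := trans_mem_maximalAtlas hφ hf hf'
  refine ⟨φ.trans f, hψ, ⟨hx, hxf⟩, fun q hq ↦
    (cov_coordField_eq_zero_iff hψ hq).1 fun a ↦ ?_⟩
  ext1 v
  apply (isInvertible_chartDeriv hφ hq.1).injective
  have hdiff : ∀ᶠ y in 𝓝 (φ q), DifferentiableAt ℝ f y := by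
    filter_upwards [f.open_source.mem_nhds hq.2] with y hy
    exact (hf.contDiffAt (f.open_source.mem_nhds hy)).differentiableAt (by simp)
  -- With `T = Df`, the derivative of `T⁻¹` contributes `-Γ T⁻¹ eₐ`, which cancels the connection
  -- term `Γ T⁻¹ eₐ`.
  rw [chartDeriv_cov_coordField_change hφ hψ hq.1 hq hdiff (Eventually.of_forall fun _ ↦ rfl)
    ((hder _ hq.2).2.inverse_of_mul (hder _ hq.2).1)]
  simp

/-- If there are charts with vanishing Christoffel symbols around all points, then the curvature
vanishes. -/
theorem isCurvatureFlat_of_exists_chart [T2Space M]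
    (hsmooth : cov.ContMDiffCovariantDerivative ∞) (htorsion : cov.torsion = 0)
    (h : ∀ x : M, ∃ ψ ∈ IsManifold.maximalAtlas (𝓡 n) ∞ M, x ∈ ψ.source ∧
      ∀ q ∈ ψ.source, ∀ i j k : Fin n, christoffel cov ψ i j k q = 0) :
    IsCurvatureFlat cov := by
  intro φ hφ q hq
  refine (curvature_eq_zero_iff hsmooth htorsion hφ hq).2 ?_
  obtain ⟨ψ, hψ, hqψ, hψ0⟩ := h q
  set f : EuclideanSpace ℝ (Fin n) → EuclideanSpace ℝ (Fin n) := fun y ↦ ψ (φ.symm y) with hf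
  have hfs : ∀ r ∈ φ.source ∩ ψ.source, ContDiffAt ℝ ∞ f (φ r) := by
    intro r hr
    refine contMDiffAt_iff_contDiffAt.1 (ContMDiffAt.comp (φ r) (I' := 𝓡 n) ?_
      (contMDiffAt_symm_of_mem_maximalAtlas hφ (φ.map_source hr.1)))
    rw [φ.left_inv hr.1]
    exact contMDiffAt_of_mem_maximalAtlas hψ hr.2
  have hfψ : ∀ r ∈ φ.source, ∀ᶠ r' in 𝓝 r, ψ r' = f (φ r') := fun r hr ↦ by
    filter_upwards [φ.open_source.mem_nhds hr] with r' hr'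
    simp only [hf, φ.left_inv hr']
  have hinv : ∀ r ∈ φ.source ∩ ψ.source, (fderiv ℝ f (φ r)).IsInvertible := fun r hr ↦
    isInvertible_fderiv_change hφ hψ hr.1 hr.2 ((hfs r hr).differentiableAt (by simp))
      (hfψ r hr.1)
  -- The columns of `(Df)⁻¹` are the components in `φ` of the parallel coordinate fields of `ψ`;
  -- hence `dW = -Γ W`.
  have hW : ∀ r ∈ φ.source ∩ ψ.source,
      DifferentiableAt ℝ (fun y ↦ (fderiv ℝ f y).inverse) (φ r) ∧
      ∀ v u, fderiv ℝ (fun y ↦ (fderiv ℝ f y).inverse) (φ r) v u =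
        -connForm cov φ (φ r) v ((fderiv ℝ f (φ r)).inverse u) := by
    intro r hr
    have hd : DifferentiableAt ℝ (fun y ↦ (fderiv ℝ f y).inverse) (φ r) := by
      have h1 : ContDiffAt ℝ 1 (fderiv ℝ f) (φ r) :=
        (hfs r hr).fderiv_right (WithTop.coe_le_coe.2 le_top)
      exact (((hinv r hr).contDiffAt_map_inverse (n := 1)).comp (φ r) h1).differentiableAt (by simp)
    have h1 : ContDiffAt ℝ 1 f (φ r) := (hfs r hr).of_le (by simp)
    have hdiff : ∀ᶠ y in 𝓝 (φ r), DifferentiableAt ℝ f y :=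
      (h1.eventually (by simp)).mono fun y hy ↦ hy.differentiableAt (by simp)
    refine ⟨hd, fun v u ↦ ?_⟩
    have hva : ∀ a, fderiv ℝ (fun y ↦ (fderiv ℝ f y).inverse) (φ r) v (stdVec a) =
        -connForm cov φ (φ r) v ((fderiv ℝ f (φ r)).inverse (stdVec a)) := fun a ↦ by
      have h1 := chartDeriv_cov_coordField_change (cov := cov) hφ hψ hr.1 hr.2 hdiff (hfψ r hr.1)
        hd.hasFDerivAt a ((chartDeriv φ r).inverse v)
      rw [(cov_coordField_eq_zero_iff hψ hr.2).2 (hψ0 r hr.2) a,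
        (isInvertible_chartDeriv hφ hr.1).self_apply_inverse] at h1
      simp only [_root_.zero_apply, map_zero] at h1
      exact eq_neg_of_add_eq_zero_left h1.symm
    rw [← sum_smul_stdVec u]
    simp [hva]
  refine fun v w ↦ flat_of_eventually_fderiv_apply
    (((contDiffOn_connForm hsmooth hφ).contDiffAt
      (φ.open_target.mem_nhds (φ.map_source hq))).differentiableAt (by simp))
    (W := fun y ↦ (fderiv ℝ f y).inverse) ?_ (hinv q ⟨hq, hqψ⟩).inverse v w
  have hnear : φ.target ∩ φ.symm ⁻¹' ψ.source ∈ 𝓝 (φ q) :=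
    (φ.isOpen_inter_preimage_symm ψ.open_source).mem_nhds
      ⟨φ.map_source hq, by rwa [mem_preimage, φ.left_inv hq]⟩
  filter_upwards [hnear] with y hy
  have := hW (φ.symm y) ⟨φ.map_target hy.1, hy.2⟩
  rwa [φ.right_inv hy.1] at this

end Curvature

end AffineManifold

end

/-! ### The cycle of implications -/

theorem theorem2p6 {n : ℕ} {M : Type*} [TopologicalSpace M] [T2Space M]
    [ChartedSpace (EuclideanSpace ℝ (Fin n)) M] [IsManifold (𝓡 n) ∞ M]
    (cov : CovariantDerivative (𝓡 n) (EuclideanSpace ℝ (Fin n))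
      (TangentSpace (𝓡 n) : M → Type _))
    (hsmooth : cov.ContMDiffCovariantDerivative ∞)
    (htorsion : cov.torsion = 0) :
    List.TFAE [
      AffineManifold.IsCurvatureFlat cov,
      ∀ x : M, ∃ φ ∈ IsManifold.maximalAtlas (𝓡 n) ∞ M, x ∈ φ.source ∧
        ∀ q ∈ φ.source, ∀ i j k : Fin n, AffineManifold.christoffel cov φ i j k q = 0,
      ∀ x : M, ∃ φ ∈ IsManifold.maximalAtlas (𝓡 n) ∞ M, x ∈ φ.source ∧
        ∀ q ∈ φ.source, ∀ l p i s : Fin n,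
          AffineManifold.chartPartial φ p (AffineManifold.christoffel cov φ l i s) q = 0 ∧
          ∑ m, AffineManifold.christoffel cov φ l p m q *
            AffineManifold.christoffel cov φ m i s q = 0,
      ∀ x : M, ∃ φ ∈ IsManifold.maximalAtlas (𝓡 n) ∞ M, x ∈ φ.source ∧
        ∀ q ∈ φ.source, ∀ l p i s : Fin n,
          AffineManifold.chartPartial φ p (AffineManifold.christoffel cov φ l i s) q +
          ∑ m, AffineManifold.christoffel cov φ l p m q *
            AffineManifold.christoffel cov φ m i s q = 0] := by
  tfae_have 1 → 2 := fun h x ↦ by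
    have hφ := IsManifold.chart_mem_maximalAtlas (I := 𝓡 n) (n := ∞) x
    exact AffineManifold.exists_chart_christoffel_eq_zero hsmooth htorsion hφ
      (mem_chart_source _ x) (h _ hφ)
  tfae_have 2 → 3 := fun h x ↦ by
    obtain ⟨φ, hφ, hx, h0⟩ := h x
    refine ⟨φ, hφ, hx, fun q hq l p i s ↦ ⟨?_, by simp [h0 q hq]⟩⟩
    rw [AffineManifold.chartPartial_congr hq p (g := fun _ ↦ 0) fun r hr ↦ h0 r hr l i s]
    simp [AffineManifold.chartPartial]
  tfae_have 3 → 4 := fun h x ↦ by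
    obtain ⟨φ, hφ, hx, h0⟩ := h x
    exact ⟨φ, hφ, hx, fun q hq l p i s ↦ by rw [(h0 q hq l p i s).1, (h0 q hq l p i s).2, add_zero]⟩
  tfae_have 4 → 1 := fun h ↦ by
    -- Statement (iv) gives flatness only in the charts it supplies; passing through charts with
    -- vanishing symbols extends it to all charts.
    refine AffineManifold.isCurvatureFlat_of_exists_chart hsmooth htorsion fun x ↦ ?_
    obtain ⟨φ, hφ, hx, h0⟩ := h x
    refine AffineManifold.exists_chart_christoffel_eq_zero hsmooth htorsion hφ hx
      fun q hq l i j k ↦ ?_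
    have hsymm := fun l i j ↦ fun r (hr : r ∈ φ.source) ↦
      AffineManifold.christoffel_symm htorsion hφ hr l i j
    -- After swapping lower indices, the curvature component is the difference of these two
    -- instances of (iv).
    have hj := h0 q hq l j k i
    have hk := h0 q hq l k j i
    rw [AffineManifold.curvature, AffineManifold.chartPartial_congr hq j (hsymm l i k),
      AffineManifold.chartPartial_congr hq k (hsymm l i j)]
    simp only [hsymm _ i _ q hq]
    linarith
  tfae_finish
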